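/- Let $d\in\mathbb N$ and $a,b>0$. Let $\mathcal M(\mathbb R^d)$ be the set of positive Radon measures with finite mass on $\mathbb R^d$, and let $\mathcal M^s(\mathbb R^d)$ be the space of finite signed Radon measures, i.e. of differences $\mu_+-\mu_-$ with $\mu_+,\mu_-\in\mathcal M(\mathbb R^d)$. The mass of $\sigma\in\mathcal M^s(\mathbb R^d)$ with Jordan decomposition $\sigma=\sigma_+^J-\sigma_-^J$ is $|\sigma|=\sigma_+^J(\mathbb R^d)+\sigma_-^J(\mathbb R^d)$. For $\mu,\nu\in\mathcal M(\mathbb R^d)$ with $|\mu|=|\nu|$ let $$W_1(\mu,\nu)=\inf_{\pi\in\Pi(\mu,\nu)}\int_{\mathbb R^d\times\mathbb R^d}|x-y|\,d\pi(x,y)\in[0,\infty],$$ where $\Pi(\mu,\nu)$ is the set of positive Borel measures on $\mathbb R^d\times\mathbb R^d$ with marginals $\mu$ and $\nu$. For arbitrary $\mu,\nu\in\mathcal M(\mathbb R^d)$ let $$W_1^{a,b}(\mu,\nu)=\inf_{\tilde\mu,\tilde\nu\in\mathcal M(\mathbb R^d),\ |\tilde\mu|=|\tilde\nu|}\Big(a\big(|\mu-\tilde\mu|+|\nu-\tilde\nu|\big)+b\,W_1(\tilde\mu,\tilde\nu)\Big).$$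 For $\mu,\nu\in\mathcal M^s(\mathbb R^d)$ put $$\mathbb W_1^{a,b}(\mu,\nu)=W_1^{a,b}(\mu_++\nu_-,\ \mu_-+\nu_+),$$ where $\mu_\pm,\nu_\pm\in\mathcal M(\mathbb R^d)$ are any measures with $\mu=\mu_+-\mu_-$ and $\nu=\nu_+-\nu_-$. Then $\mathbb W_1^{a,b}(\mu,\nu)$ does not depend on the choice of these decompositions, and $\mathbb W_1^{a,b}$ is a distance on $\mathcal M^s(\mathbb R^d)$: for all $\mu,\nu,\eta\in\mathcal M^s(\mathbb R^d)$ it is finite and nonnegative, $\mathbb W_1^{a,b}(\mu,\nu)=0$ if and only if $\mu=\nu$, $\mathbb W_1^{a,b}(\mu,\nu)=\mathbb W_1^{a,b}(\nu,\mu)$, and $\mathbb W_1^{a,b}(\mu,\eta)\le\mathbb W_1^{a,b}(\mu,\nu)+\mathbb W_1^{a,b}(\nu,\eta)$. -/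

import Mathlib

open MeasureTheory
open scoped ENNReal

noncomputable section

namespace SignedWasserstein

/-- The Euclidean space `ℝ^d`. Finite Borel measures on it (`FiniteMeasure (Rd d)`) are exactly the
positive Radon measures with finite mass, and `SignedMeasure (Rd d)` is the space of differences
of two such measures. -/
abbrev Rd (d : ℕ) : Type := EuclideanSpace ℝ (Fin d)

/-- The transference plans between `μ` and `ν`: measures on the product with marginals `μ`, `ν`. -/
def transferencePlans {d : ℕ} (μ ν : FiniteMeasure (Rd d)) : Set (Measure (Rd d × Rd d)) :=
  {π | (∀ A : Set (Rd d), MeasurableSet A → π (A ×ˢ Set.univ) = (μ : Measure (Rd d)) A) ∧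
    (∀ B : Set (Rd d), MeasurableSet B → π (Set.univ ×ˢ B) = (ν : Measure (Rd d)) B)}

/-- The `1`-Wasserstein distance between two measures (of the same mass), with values in `[0, ∞]`;
it is `∞` when every transference plan has infinite cost. -/
def W₁ {d : ℕ} (μ ν : FiniteMeasure (Rd d)) : ℝ≥0∞ :=
  ⨅ π ∈ transferencePlans μ ν, ∫⁻ z, ENNReal.ofReal ‖z.1 - z.2‖ ∂π

/-- The signed measure `μ - ν`. -/
def diff {d : ℕ} (μ ν : FiniteMeasure (Rd d)) : SignedMeasure (Rd d) :=
  (μ : Measure (Rd d)).toSignedMeasure - (ν : Measure (Rd d)).toSignedMeasure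

/-- The mass `|σ| = |σ₊| + |σ₋|` of a signed measure, through its Jordan decomposition. -/
def signedMass {d : ℕ} (σ : SignedMeasure (Rd d)) : ℝ≥0∞ :=
  σ.totalVariation Set.univ

/-- The generalized Wasserstein distance `W₁^{a,b}` between two finite positive measures. -/
def genW {d : ℕ} (a b : ℝ) (μ ν : FiniteMeasure (Rd d)) : ℝ≥0∞ :=
  ⨅ (μ' : FiniteMeasure (Rd d)) (ν' : FiniteMeasure (Rd d)) (_ : μ'.mass = ν'.mass),
    ENNReal.ofReal a * (signedMass (diff μ μ') + signedMass (diff ν ν')) +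
      ENNReal.ofReal b * W₁ μ' ν'

/-- The positive part of the Jordan decomposition. -/
def jordanPos {d : ℕ} (σ : SignedMeasure (Rd d)) : FiniteMeasure (Rd d) :=
  ⟨σ.toJordanDecomposition.posPart, σ.toJordanDecomposition.posPart_finite⟩

/-- The negative part of the Jordan decomposition. -/
def jordanNeg {d : ℕ} (σ : SignedMeasure (Rd d)) : FiniteMeasure (Rd d) :=
  ⟨σ.toJordanDecomposition.negPart, σ.toJordanDecomposition.negPart_finite⟩

/-- The generalized Wasserstein distance `𝕎₁^{a,b}` between signed measures, computed with the
Jordan decompositions. That every other choice of decompositions gives the same value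
is a claim to be proved, not part of the definition. -/
def signedW {d : ℕ} (a b : ℝ) (μ ν : SignedMeasure (Rd d)) : ℝ≥0∞ :=
  genW a b (jordanPos μ + jordanNeg ν) (jordanNeg μ + jordanPos ν)

end SignedWasserstein

end

open Filter Topology ProbabilityTheory
open scoped NNReal

/-! Choosing two auxiliary measures and a plan between them amounts to choosing one finite measure
`π` on the product, so `genW` is the infimum of `planCost` over all such `π`
(`genW_eq_iInf_planCost`). Sums, multiples and swaps of plans give subadditivity, scaling and
symmetry; `exists_gluing` gives the triangle inequality.

The crux is the cancellation law `genW_add_right`. Replacing `n` copies of `μ` by `ν` one at a time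
in the presence of `η` costs at most `n * genW (μ + η) (ν + η)`. Dividing by `n` shrinks the
spectator to `η / n`, whose removal costs O(1/n).

Cancellation makes the signed distance independent of the decompositions and, with subadditivity,
yields its triangle inequality. Definiteness comes from testing against bounded Lipschitz functions.
-/

namespace SignedWasserstein

/-! ### Total variation through truncated subtraction of measures -/

section TotalVariation

variable {X : Type*} [MeasurableSpace X]

/-- The total variation `|μ - ν|` of the difference of two positive measures. -/
noncomputable def tvDist (μ ν : Measure X) : ℝ≥0∞ :=
  (μ - ν) Set.univ + (ν - μ) Set.univ

theorem add_sub_eq_add_sub (μ ν : Measure X) [IsFiniteMeasure μ] [IsFiniteMeasure ν] :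
    μ + (ν - μ) = ν + (μ - ν) := by
  have h := Measure.sub_toSignedMeasure_eq_toSignedMeasure_sub (μ := μ) (ν := ν)
  rw [← Measure.toSignedMeasure_eq_toSignedMeasure_iff, Measure.toSignedMeasure_add,
    Measure.toSignedMeasure_add]
  rw [sub_eq_sub_iff_add_eq_add] at h
  rw [h, add_comm]

theorem measure_le_sub_add (μ ν : Measure X) [IsFiniteMeasure μ] [IsFiniteMeasure ν] :
    μ ≤ (μ - ν) + ν := by
  rw [add_comm, ← add_sub_eq_add_sub]
  exact Measure.le_add_right le_rfl

/-- Truncated differences are minimal among such `α`, `β`; bounds on `tvDist` below reduce to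
exhibiting a pair. -/
theorem tvDist_le {μ ν α β : Measure X} (h₁ : μ ≤ α + ν) (h₂ : ν ≤ β + μ) :
    tvDist μ ν ≤ α Set.univ + β Set.univ :=
  add_le_add (Measure.sub_le_of_le_add h₁ _) (Measure.sub_le_of_le_add h₂ _)

theorem tvDist_comm (μ ν : Measure X) : tvDist μ ν = tvDist ν μ := add_comm _ _

theorem tvDist_self (μ : Measure X) : tvDist μ μ = 0 := by
  simp [tvDist]

theorem tvDist_add_right_le (μ θ : Measure X) : tvDist μ (μ + θ) ≤ θ Set.univ := by
  have h : tvDist μ (μ + θ) ≤ (0 : Measure X) Set.univ + θ Set.univ :=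
    tvDist_le (by rw [zero_add]; exact Measure.le_add_right le_rfl) (by rw [add_comm])
  simpa using h

theorem tvDist_triangle (μ ν η : Measure X) [IsFiniteMeasure μ] [IsFiniteMeasure ν]
    [IsFiniteMeasure η] : tvDist μ η ≤ tvDist μ ν + tvDist ν η := by
  have h : tvDist μ η ≤ ((μ - ν) + (ν - η)) Set.univ + ((η - ν) + (ν - μ)) Set.univ := by
    refine tvDist_le ?_ ?_
    · rw [add_assoc]
      exact (measure_le_sub_add μ ν).trans (add_le_add le_rfl (measure_le_sub_add ν η))
    · rw [add_assoc]
      exact (measure_le_sub_add η ν).trans (add_le_add le_rfl (measure_le_sub_add ν μ))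
  refine h.trans (le_of_eq ?_)
  simp only [tvDist, Measure.add_apply]
  ring

theorem tvDist_add_le (μ₁ μ₂ ν₁ ν₂ : Measure X) [IsFiniteMeasure μ₁] [IsFiniteMeasure μ₂]
    [IsFiniteMeasure ν₁] [IsFiniteMeasure ν₂] :
    tvDist (μ₁ + μ₂) (ν₁ + ν₂) ≤ tvDist μ₁ ν₁ + tvDist μ₂ ν₂ := by
  have h : tvDist (μ₁ + μ₂) (ν₁ + ν₂) ≤
      ((μ₁ - ν₁) + (μ₂ - ν₂)) Set.univ + ((ν₁ - μ₁) + (ν₂ - μ₂)) Set.univ := by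
    refine tvDist_le ?_ ?_
    · rw [add_add_add_comm]
      exact add_le_add (measure_le_sub_add _ _) (measure_le_sub_add _ _)
    · rw [add_add_add_comm]
      exact add_le_add (measure_le_sub_add _ _) (measure_le_sub_add _ _)
  refine h.trans (le_of_eq ?_)
  simp only [tvDist, Measure.add_apply]
  ring

theorem tvDist_smul_le (c : ℝ≥0) (μ ν : Measure X) [IsFiniteMeasure μ] [IsFiniteMeasure ν] :
    tvDist (c • μ) (c • ν) ≤ c * tvDist μ ν := by
  have h : tvDist (c • μ) (c • ν) ≤ (c • (μ - ν)) Set.univ + (c • (ν - μ)) Set.univ := by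
    refine tvDist_le ?_ ?_
    · rw [← smul_add]
      gcongr
      exact measure_le_sub_add μ ν
    · rw [← smul_add]
      gcongr
      exact measure_le_sub_add ν μ
  refine h.trans (le_of_eq ?_)
  simp only [tvDist, Measure.smul_apply, mul_add]
  rfl

theorem lintegral_le_add_tvDist {f : X → ℝ≥0∞} (hf : ∀ x, f x ≤ 1) (μ ν : Measure X)
    [IsFiniteMeasure μ] [IsFiniteMeasure ν] :
    ∫⁻ x, f x ∂μ ≤ ∫⁻ x, f x ∂ν + tvDist μ ν := by
  calc ∫⁻ x, f x ∂μ ≤ ∫⁻ x, f x ∂((μ - ν) + ν) := lintegral_mono' (measure_le_sub_add μ ν) le_rfl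
    _ = ∫⁻ x, f x ∂(μ - ν) + ∫⁻ x, f x ∂ν := lintegral_add_measure _ _ _
    _ ≤ (μ - ν) Set.univ + ∫⁻ x, f x ∂ν := by
        gcongr
        exact (lintegral_mono hf).trans (by simp)
    _ ≤ ∫⁻ x, f x ∂ν + tvDist μ ν := by
        rw [add_comm]
        gcongr
        exact le_self_add

/-- Two finite measures have a common part `ρ`, and the masses of the two remainders add up
to the total variation of the difference. -/
theorem exists_common_part (μ ν : Measure X) [IsFiniteMeasure μ] [IsFiniteMeasure ν] :
    ∃ ρ : Measure X, ρ + (μ - ν) = μ ∧ ρ + (ν - μ) = ν := by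
  have h₁ : μ - (μ - ν) + (μ - ν) = μ := Measure.sub_add_cancel_of_le Measure.sub_le
  refine ⟨μ - (μ - ν), h₁, ?_⟩
  -- The goal with `μ - ν` added to both sides; it is then cancelled in the group of signed
  -- measures.
  have h₂ : μ - (μ - ν) + (ν - μ) + (μ - ν) = ν + (μ - ν) := by
    rw [add_right_comm, h₁, add_sub_eq_add_sub]
  rw [← Measure.toSignedMeasure_eq_toSignedMeasure_iff] at h₂ ⊢
  rw [Measure.toSignedMeasure_add _ (μ - ν), Measure.toSignedMeasure_add ν] at h₂
  exact add_right_cancel h₂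

end TotalVariation

/-! ### Gluing of plans -/

section Gluing

variable {X : Type*} [MeasurableSpace X]

theorem fst_comp_prod_of_isMarkov {Y Z : Type*} [MeasurableSpace Y] [MeasurableSpace Z]
    (ρ : Measure X) [IsFiniteMeasure ρ] (κ : Kernel X Y) (η : Kernel X Z)
    [IsMarkovKernel κ] [IsMarkovKernel η] :
    ((κ ×ₖ η) ∘ₘ ρ).fst = κ ∘ₘ ρ := by
  ext s hs
  rw [Measure.fst_apply hs, Measure.bind_apply (measurable_fst hs) (Kernel.aemeasurable _),
    Measure.bind_apply hs (Kernel.aemeasurable _)]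
  refine lintegral_congr fun x => ?_
  rw [Kernel.prod_apply, ← Set.prod_univ, Measure.prod_prod]
  simp

theorem snd_comp_prod_of_isMarkov {Y Z : Type*} [MeasurableSpace Y] [MeasurableSpace Z]
    (ρ : Measure X) [IsFiniteMeasure ρ] (κ : Kernel X Y) (η : Kernel X Z)
    [IsMarkovKernel κ] [IsMarkovKernel η] :
    ((κ ×ₖ η) ∘ₘ ρ).snd = η ∘ₘ ρ := by
  ext s hs
  rw [Measure.snd_apply hs, Measure.bind_apply (measurable_snd hs) (Kernel.aemeasurable _),
    Measure.bind_apply hs (Kernel.aemeasurable _)]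
  refine lintegral_congr fun x => ?_
  rw [Kernel.prod_apply, ← Set.univ_prod, Measure.prod_prod]
  simp

variable [PseudoEMetricSpace X] [BorelSpace X] [SecondCountableTopology X]
  [StandardBorelSpace X] [Nonempty X]

/-- Gluing of two plans whose intermediate marginals need not agree. -/
theorem exists_gluing (π₁ π₂ : Measure (X × X)) [IsFiniteMeasure π₁] [IsFiniteMeasure π₂] :
    ∃ π : Measure (X × X), IsFiniteMeasure π ∧
      tvDist π₁.fst π.fst + tvDist π₂.snd π.snd ≤ tvDist π₁.snd π₂.fst ∧
      ∫⁻ z, edist z.1 z.2 ∂π ≤ ∫⁻ z, edist z.1 z.2 ∂π₁ + ∫⁻ z, edist z.1 z.2 ∂π₂ := by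
  obtain ⟨ρ, h₁, h₂⟩ := exists_common_part π₁.snd π₂.fst
  have hρ : IsFiniteMeasure ρ := isFiniteMeasure_of_le π₁.snd (h₁ ▸ Measure.le_add_right le_rfl)
  -- `condKernel` conditions on the first coordinate, so `π₁` is swapped to be conditioned on the
  -- middle variable.
  set σ : Measure (X × X) := π₁.map Prod.swap with hσ
  have hσf : σ.fst = π₁.snd := Measure.fst_map_swap
  have hσs : σ.snd = π₁.fst := Measure.snd_map_swap
  have d₁ : σ.fst ⊗ₘ σ.condKernel = σ := σ.disintegrate σ.condKernel
  have d₂ : π₂.fst ⊗ₘ π₂.condKernel = π₂ := π₂.disintegrate π₂.condKernel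
  set κ := σ.condKernel
  set η := π₂.condKernel
  -- Only the common middle part `ρ` is glued. The outer mass lost is the Markov image of the
  -- discarded middle mass, hence of equal size.
  have e₁ : κ ∘ₘ ρ + κ ∘ₘ (π₁.snd - π₂.fst) = π₁.fst := by
    rw [← Measure.comp_add, h₁, ← hσs, ← hσf, ← Measure.snd_compProd, d₁]
  have e₂ : η ∘ₘ ρ + η ∘ₘ (π₂.fst - π₁.snd) = π₂.snd := by
    rw [← Measure.comp_add, h₂, ← Measure.snd_compProd, d₂]
  refine ⟨(κ ×ₖ η) ∘ₘ ρ, inferInstance, ?_, ?_⟩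
  · rw [fst_comp_prod_of_isMarkov, snd_comp_prod_of_isMarkov]
    refine add_le_add ?_ ?_
    · rw [tvDist_comm, ← e₁]
      exact (tvDist_add_right_le _ _).trans (by simp)
    · rw [tvDist_comm, ← e₂]
      exact (tvDist_add_right_le _ _).trans (by simp)
  · have hm : Measurable fun z : X × X => edist z.1 z.2 := measurable_edist
    have l₁ : ∫⁻ y, ∫⁻ x, edist x y ∂κ y ∂ρ ≤ ∫⁻ z, edist z.1 z.2 ∂π₁ := by
      calc ∫⁻ y, ∫⁻ x, edist x y ∂κ y ∂ρ ≤ ∫⁻ y, ∫⁻ x, edist x y ∂κ y ∂π₁.snd :=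
            lintegral_mono' (h₁ ▸ Measure.le_add_right le_rfl) le_rfl
        _ = ∫⁻ z, edist z.2 z.1 ∂σ := by
            conv_rhs => rw [← d₁]
            rw [Measure.lintegral_compProd (by fun_prop), hσf]
        _ = ∫⁻ z, edist z.1 z.2 ∂π₁ := by
            rw [hσ, lintegral_map (by fun_prop) measurable_swap]
            rfl
    have l₂ : ∫⁻ y, ∫⁻ x, edist y x ∂η y ∂ρ ≤ ∫⁻ z, edist z.1 z.2 ∂π₂ := by
      calc ∫⁻ y, ∫⁻ x, edist y x ∂η y ∂ρ ≤ ∫⁻ y, ∫⁻ x, edist y x ∂η y ∂π₂.fst :=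
            lintegral_mono' (h₂ ▸ Measure.le_add_right le_rfl) le_rfl
        _ = ∫⁻ z, edist z.1 z.2 ∂π₂ := by
            conv_rhs => rw [← d₂]
            rw [Measure.lintegral_compProd (by fun_prop)]
    refine le_trans ?_ (add_le_add l₁ l₂)
    rw [Measure.lintegral_bind (Kernel.aemeasurable _) hm.aemeasurable, ← lintegral_add_right]
    · refine lintegral_mono fun y => ?_
      calc ∫⁻ z, edist z.1 z.2 ∂(κ ×ₖ η) y
          ≤ ∫⁻ z, (edist z.1 y + edist y z.2) ∂((κ y).prod (η y)) := by
            rw [Kernel.prod_apply]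
            exact lintegral_mono fun z => edist_triangle _ _ _
        _ = ∫⁻ z, edist z.1 y ∂((κ y).prod (η y)) + ∫⁻ z, edist y z.2 ∂((κ y).prod (η y)) :=
            lintegral_add_left (by fun_prop) _
        _ = ∫⁻ x, edist x y ∂κ y + ∫⁻ x, edist y x ∂η y := by
            rw [lintegral_prod _ (by fun_prop), lintegral_prod _ (by fun_prop)]
            simp
    · exact Measurable.lintegral_kernel_prod_right' (f := fun z : X × X => edist z.1 z.2) hm

end Gluing

/-! ### Transport cost against Lipschitz functions -/

section Lipschitz

variable {X : Type*} [MeasurableSpace X] [PseudoEMetricSpace X] [BorelSpace X]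
  [SecondCountableTopology X]

theorem lintegral_fst_le_of_lipschitzWith {f : X → ℝ≥0} {K : ℝ≥0} (hf : LipschitzWith K f)
    (π : Measure (X × X)) :
    ∫⁻ x, f x ∂π.fst ≤ ∫⁻ x, f x ∂π.snd + K * ∫⁻ z, edist z.1 z.2 ∂π := by
  have hm : Measurable fun x => (f x : ℝ≥0∞) := hf.continuous.measurable.coe_nnreal_ennreal
  rw [Measure.fst, Measure.snd, lintegral_map hm measurable_fst, lintegral_map hm measurable_snd,
    ← lintegral_const_mul _ measurable_edist,
    ← lintegral_add_left (f := fun z : X × X => (f z.2 : ℝ≥0∞)) (hm.comp measurable_snd)]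
  refine lintegral_mono fun z => ?_
  have h := hf z.1 z.2
  calc (f z.1 : ℝ≥0∞) ≤ f z.2 + edist (f z.1) (f z.2) := by
        rw [edist_nndist, ← ENNReal.coe_add, ENNReal.coe_le_coe, ← NNReal.coe_le_coe,
          NNReal.coe_add, coe_nndist, NNReal.dist_eq]
        linarith [le_abs_self ((f z.1 : ℝ) - f z.2)]
    _ ≤ f z.2 + K * edist z.1 z.2 := by gcongr

end Lipschitz

/-! ### The generalized distance on positive measures -/

variable {d : ℕ} {a b : ℝ}

theorem signedMass_diff (μ ν : FiniteMeasure (Rd d)) :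
    signedMass (diff μ ν) = tvDist (μ : Measure (Rd d)) ν := by
  rw [signedMass, diff, SignedMeasure.totalVariation,
    Measure.toJordanDecomposition_toSignedMeasure_sub]
  rfl

/-- The cost of a plan whose marginals need not be `μ` and `ν`. -/
noncomputable def planCost (a b : ℝ) (μ ν : Measure (Rd d)) (π : Measure (Rd d × Rd d)) : ℝ≥0∞ :=
  ENNReal.ofReal a * (tvDist μ π.fst + tvDist ν π.snd) +
    ENNReal.ofReal b * ∫⁻ z, edist z.1 z.2 ∂π

theorem lintegral_ofReal_norm_sub (π : Measure (Rd d × Rd d)) :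
    ∫⁻ z, ENNReal.ofReal ‖z.1 - z.2‖ ∂π = ∫⁻ z, edist z.1 z.2 ∂π := by
  simp only [edist_dist, dist_eq_norm]

theorem mem_transferencePlans_iff (μ ν : FiniteMeasure (Rd d)) (π : Measure (Rd d × Rd d)) :
    π ∈ transferencePlans μ ν ↔ π.fst = μ ∧ π.snd = ν := by
  refine and_congr ?_ ?_
  · refine ⟨fun h => Measure.ext fun s hs => ?_, fun h A hA => ?_⟩
    · rw [Measure.fst_apply hs, ← Set.prod_univ, h s hs]
    · rw [← h, Measure.fst_apply hA, Set.prod_univ]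
  · refine ⟨fun h => Measure.ext fun s hs => ?_, fun h A hA => ?_⟩
    · rw [Measure.snd_apply hs, ← Set.univ_prod, h s hs]
    · rw [← h, Measure.snd_apply hA, Set.univ_prod]

theorem genW_eq_iInf_planCost (hb : 0 < b) (μ ν : FiniteMeasure (Rd d)) :
    genW a b μ ν = ⨅ π : FiniteMeasure (Rd d × Rd d),
      planCost a b (μ : Measure (Rd d)) ν (π : Measure (Rd d × Rd d)) := by
  -- An infimum over no admissible plan is `∞`, and `0 * ∞ = 0` would break the exchange of product
  -- and infimum.
  have hb0 : ENNReal.ofReal b ≠ 0 := by simpa using hb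
  apply le_antisymm
  · refine le_iInf fun π => ?_
    let μ' : FiniteMeasure (Rd d) := ⟨(π : Measure (Rd d × Rd d)).fst, inferInstance⟩
    let ν' : FiniteMeasure (Rd d) := ⟨(π : Measure (Rd d × Rd d)).snd, inferInstance⟩
    have hmass : μ'.mass = ν'.mass := by
      rw [← ENNReal.coe_inj, FiniteMeasure.ennreal_mass, FiniteMeasure.ennreal_mass]
      exact Measure.fst_univ.trans Measure.snd_univ.symm
    refine (iInf_le_of_le μ' <| iInf_le_of_le ν' <| iInf_le _ hmass).trans ?_
    rw [signedMass_diff, signedMass_diff, planCost]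
    gcongr
    · rfl
    · rfl
    · refine (iInf₂_le (π : Measure (Rd d × Rd d)) ?_).trans (lintegral_ofReal_norm_sub _).le
      exact (mem_transferencePlans_iff _ _ _).2 ⟨rfl, rfl⟩
  · refine le_iInf fun μ' => le_iInf fun ν' => le_iInf fun _ => ?_
    rw [signedMass_diff, signedMass_diff, W₁, ENNReal.mul_iInf_of_ne hb0 ENNReal.ofReal_ne_top,
      ENNReal.add_iInf]
    refine le_iInf fun π => ?_
    rw [ENNReal.mul_iInf_of_ne hb0 ENNReal.ofReal_ne_top, ENNReal.add_iInf]
    refine le_iInf fun hπ => ?_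
    rw [mem_transferencePlans_iff] at hπ
    have hfin : IsFiniteMeasure π :=
      ⟨by rw [← Measure.fst_univ, hπ.1]; exact measure_lt_top _ _⟩
    refine iInf_le_of_le ⟨π, hfin⟩ ?_
    rw [planCost, FiniteMeasure.toMeasure_mk, hπ.1, hπ.2, lintegral_ofReal_norm_sub]

theorem genW_le_planCost (hb : 0 < b) (μ ν : FiniteMeasure (Rd d)) (π : Measure (Rd d × Rd d))
    [hπ : IsFiniteMeasure π] : genW a b μ ν ≤ planCost a b μ ν π := by
  rw [genW_eq_iInf_planCost hb]
  exact iInf_le_of_le ⟨π, hπ⟩ le_rfl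

theorem genW_self (hb : 0 < b) (μ : FiniteMeasure (Rd d)) : genW a b μ μ = 0 := by
  have hm : Measurable fun x : Rd d => (x, x) := by fun_prop
  refine le_antisymm ((genW_le_planCost hb μ μ
    ((μ : Measure (Rd d)).map fun x => (x, x))).trans (le_of_eq ?_)) zero_le
  rw [planCost, Measure.fst, Measure.snd, Measure.map_map measurable_fst hm,
    Measure.map_map measurable_snd hm, lintegral_map measurable_edist hm]
  simp [Function.comp_def, tvDist_self]

theorem genW_le_comm (hb : 0 < b) (μ ν : FiniteMeasure (Rd d)) : genW a b μ ν ≤ genW a b ν μ := by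
  rw [genW_eq_iInf_planCost hb ν μ]
  refine le_iInf fun π => (genW_le_planCost hb μ ν
    ((π : Measure (Rd d × Rd d)).map Prod.swap)).trans (le_of_eq ?_)
  rw [planCost, planCost, Measure.fst_map_swap, Measure.snd_map_swap,
    lintegral_map measurable_edist measurable_swap, add_comm (tvDist _ _)]
  simp only [Prod.fst_swap, Prod.snd_swap, edist_comm]

theorem genW_comm (hb : 0 < b) (μ ν : FiniteMeasure (Rd d)) : genW a b μ ν = genW a b ν μ :=
  le_antisymm (genW_le_comm hb μ ν) (genW_le_comm hb ν μ)

/-- The diagonal plan of `ν` moves nothing. -/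
theorem genW_le_tvDist (hb : 0 < b) (μ ν : FiniteMeasure (Rd d)) :
    genW a b μ ν ≤ ENNReal.ofReal a * tvDist (μ : Measure (Rd d)) ν := by
  have hm : Measurable fun x : Rd d => (x, x) := by fun_prop
  refine (genW_le_planCost hb μ ν
    ((ν : Measure (Rd d)).map fun x => (x, x))).trans (le_of_eq ?_)
  rw [planCost, Measure.fst, Measure.snd, Measure.map_map measurable_fst hm,
    Measure.map_map measurable_snd hm, lintegral_map measurable_edist hm]
  simp [Function.comp_def, tvDist_self]

theorem genW_ne_top (hb : 0 < b) (μ ν : FiniteMeasure (Rd d)) : genW a b μ ν ≠ ∞ := by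
  refine ne_top_of_le_ne_top ?_ (genW_le_tvDist hb μ ν)
  exact ENNReal.mul_ne_top ENNReal.ofReal_ne_top
    (ENNReal.add_ne_top.2 ⟨measure_ne_top _ _, measure_ne_top _ _⟩)

theorem genW_add_le (hb : 0 < b) (μ₁ μ₂ ν₁ ν₂ : FiniteMeasure (Rd d)) :
    genW a b (μ₁ + μ₂) (ν₁ + ν₂) ≤ genW a b μ₁ ν₁ + genW a b μ₂ ν₂ := by
  rw [genW_eq_iInf_planCost hb μ₁, genW_eq_iInf_planCost hb μ₂]
  refine ENNReal.le_iInf_add_iInf fun π₁ π₂ => (genW_le_planCost hb _ _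
    ((π₁ : Measure (Rd d × Rd d)) + (π₂ : Measure (Rd d × Rd d)))).trans ?_
  have hf := tvDist_add_le (μ₁ : Measure (Rd d)) μ₂ (π₁ : Measure (Rd d × Rd d)).fst
    (π₂ : Measure (Rd d × Rd d)).fst
  have hs := tvDist_add_le (ν₁ : Measure (Rd d)) ν₂ (π₁ : Measure (Rd d × Rd d)).snd
    (π₂ : Measure (Rd d × Rd d)).snd
  simp only [planCost, FiniteMeasure.toMeasure_add, Measure.fst_add, Measure.snd_add,
    lintegral_add_measure]
  refine (add_le_add (mul_le_mul_right (add_le_add hf hs) _) le_rfl).trans (le_of_eq ?_)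
  ring

theorem genW_smul_le (hb : 0 < b) (c : ℝ≥0) (μ ν : FiniteMeasure (Rd d)) :
    genW a b (c • μ) (c • ν) ≤ c * genW a b μ ν := by
  rw [genW_eq_iInf_planCost hb μ, ENNReal.mul_iInf (by simp)]
  refine le_iInf fun π => (genW_le_planCost hb _ _ (c • (π : Measure (Rd d × Rd d)))).trans ?_
  have hf := tvDist_smul_le c (μ : Measure (Rd d)) (π : Measure (Rd d × Rd d)).fst
  have hs := tvDist_smul_le c (ν : Measure (Rd d)) (π : Measure (Rd d × Rd d)).snd
  have e₁ : (c • (π : Measure (Rd d × Rd d))).fst = c • (π : Measure (Rd d × Rd d)).fst :=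
    Measure.map_smul _ _ _
  have e₂ : (c • (π : Measure (Rd d × Rd d))).snd = c • (π : Measure (Rd d × Rd d)).snd :=
    Measure.map_smul _ _ _
  have e₃ : ∫⁻ z, edist z.1 z.2 ∂(c • (π : Measure (Rd d × Rd d))) =
      c * ∫⁻ z, edist z.1 z.2 ∂(π : Measure (Rd d × Rd d)) := lintegral_smul_measure _ _
  rw [planCost, planCost, e₁, e₂, e₃, FiniteMeasure.toMeasure_smul, FiniteMeasure.toMeasure_smul]
  refine (add_le_add (mul_le_mul_right (add_le_add hf hs) _) le_rfl).trans (le_of_eq ?_)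
  ring

/-- Gluing loses at most the mismatch of the middle marginals, which the two plans have already paid
for through their distances to `ν`, at the same weight `a`. -/
theorem genW_triangle (hb : 0 < b) (μ ν η : FiniteMeasure (Rd d)) :
    genW a b μ η ≤ genW a b μ ν + genW a b ν η := by
  rw [genW_eq_iInf_planCost hb μ ν, genW_eq_iInf_planCost hb ν η]
  refine ENNReal.le_iInf_add_iInf fun π₁ π₂ => ?_
  obtain ⟨π, hπ, htv, hcost⟩ := exists_gluing (π₁ : Measure (Rd d × Rd d)) π₂
  refine (genW_le_planCost hb μ η π).trans ?_
  set p₁ := (π₁ : Measure (Rd d × Rd d))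
  set p₂ := (π₂ : Measure (Rd d × Rd d))
  have h₁ := tvDist_triangle (μ : Measure (Rd d)) p₁.fst π.fst
  have h₂ := tvDist_triangle (η : Measure (Rd d)) p₂.snd π.snd
  have h₃ := tvDist_triangle p₁.snd (ν : Measure (Rd d)) p₂.fst
  rw [tvDist_comm p₁.snd (ν : Measure (Rd d))] at h₃
  have h : tvDist (μ : Measure (Rd d)) π.fst + tvDist (η : Measure (Rd d)) π.snd ≤
      (tvDist (μ : Measure (Rd d)) p₁.fst + tvDist (ν : Measure (Rd d)) p₁.snd) +
      (tvDist (ν : Measure (Rd d)) p₂.fst + tvDist (η : Measure (Rd d)) p₂.snd) := by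
    calc _ ≤ (tvDist (μ : Measure (Rd d)) p₁.fst + tvDist p₁.fst π.fst) +
          (tvDist (η : Measure (Rd d)) p₂.snd + tvDist p₂.snd π.snd) := add_le_add h₁ h₂
      _ = (tvDist p₁.fst π.fst + tvDist p₂.snd π.snd) +
          (tvDist (μ : Measure (Rd d)) p₁.fst + tvDist (η : Measure (Rd d)) p₂.snd) := by ring
      _ ≤ (tvDist (ν : Measure (Rd d)) p₁.snd + tvDist (ν : Measure (Rd d)) p₂.fst) +
          (tvDist (μ : Measure (Rd d)) p₁.fst + tvDist (η : Measure (Rd d)) p₂.snd) :=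
        add_le_add (htv.trans h₃) le_rfl
      _ = _ := by ring
  simp only [planCost]
  refine (add_le_add (mul_le_mul_right h _) (mul_le_mul_right hcost _)).trans (le_of_eq ?_)
  ring

/-! ### Cancellation of a common summand -/

theorem genW_add_right_le (hb : 0 < b) (μ ν η : FiniteMeasure (Rd d)) :
    genW a b (μ + η) (ν + η) ≤ genW a b μ ν := by
  simpa [genW_self hb η] using genW_add_le (a := a) hb μ η ν η

theorem genW_nsmul_add_le (hb : 0 < b) (μ ν η : FiniteMeasure (Rd d)) (n : ℕ) :
    genW a b (n • μ + η) (n • ν + η) ≤ n * genW a b (μ + η) (ν + η) := by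
  induction n with
  | zero => simp [genW_self hb]
  | succ n ih =>
    -- Exchange one `μ` for `ν`, with the other `n` copies of `μ` as a common summand; `h₂`
    -- exchanges the rest beside the new `ν`.
    have h₁ : genW a b ((n + 1) • μ + η) (n • μ + η + ν) ≤ genW a b (μ + η) (ν + η) := by
      have e₁ : (n + 1) • μ + η = μ + η + n • μ := by rw [succ_nsmul]; abel
      have e₂ : n • μ + η + ν = ν + η + n • μ := by abel
      rw [e₁, e₂]
      exact genW_add_right_le hb _ _ _
    have h₂ : genW a b (n • μ + η + ν) ((n + 1) • ν + η) ≤ n * genW a b (μ + η) (ν + η) := by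
      refine le_trans ?_ ih
      have e : (n + 1) • ν + η = n • ν + η + ν := by rw [succ_nsmul]; abel
      rw [e]
      exact genW_add_right_le hb _ _ _
    refine (genW_triangle hb _ _ _).trans ((add_le_add h₁ h₂).trans (le_of_eq ?_))
    push_cast
    ring

theorem genW_add_inv_smul_le (hb : 0 < b) (μ ν η : FiniteMeasure (Rd d)) (n : ℕ) :
    genW a b (μ + (n + 1 : ℝ≥0)⁻¹ • η) (ν + (n + 1 : ℝ≥0)⁻¹ • η) ≤
      genW a b (μ + η) (ν + η) := by
  have hn : (n + 1 : ℝ≥0) ≠ 0 := by positivity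
  have key (θ : FiniteMeasure (Rd d)) :
      (n + 1 : ℝ≥0)⁻¹ • ((n + 1) • θ + η) = θ + (n + 1 : ℝ≥0)⁻¹ • η := by
    rw [smul_add, ← Nat.cast_smul_eq_nsmul ℝ≥0, smul_smul, Nat.cast_add, Nat.cast_one,
      inv_mul_cancel₀ hn, one_smul]
  rw [← key μ, ← key ν]
  refine (genW_smul_le hb _ _ _).trans
    ((mul_le_mul_right (genW_nsmul_add_le hb μ ν η (n + 1)) _).trans (le_of_eq ?_))
  rw [← mul_assoc]
  have : (((n + 1 : ℝ≥0)⁻¹ : ℝ≥0) : ℝ≥0∞) * ((n + 1 : ℕ) : ℝ≥0∞) = 1 := by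
    rw [← ENNReal.coe_natCast, ← ENNReal.coe_mul, Nat.cast_add, Nat.cast_one,
      inv_mul_cancel₀ hn, ENNReal.coe_one]
  rw [this, one_mul]

theorem genW_le_add_smul (hb : 0 < b) (μ η : FiniteMeasure (Rd d)) (c : ℝ≥0) :
    genW a b μ (μ + c • η) ≤ c * (ENNReal.ofReal a * (η : Measure (Rd d)) Set.univ) := by
  refine (genW_le_tvDist hb _ _).trans
    ((mul_le_mul_right (tvDist_add_right_le _ _) _).trans (le_of_eq ?_))
  rw [mul_left_comm]
  rfl

/-- Adding the same measure on both sides does not change the generalized Wasserstein distance. -/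
theorem genW_add_right (hb : 0 < b) (μ ν η : FiniteMeasure (Rd d)) :
    genW a b (μ + η) (ν + η) = genW a b μ ν := by
  refine le_antisymm (genW_add_right_le hb μ ν η) ?_
  set C := ENNReal.ofReal a * (η : Measure (Rd d)) Set.univ with hC
  have hCtop : C ≠ ∞ := ENNReal.mul_ne_top ENNReal.ofReal_ne_top (measure_ne_top _ _)
  -- Path from `μ` to `ν` through `μ + η / (n + 1)` and `ν + η / (n + 1)`; the two end legs vanish
  -- in the limit.
  have hle (n : ℕ) : genW a b μ ν ≤
      (((n + 1 : ℝ≥0)⁻¹ : ℝ≥0) : ℝ≥0∞) * C +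
        (genW a b (μ + η) (ν + η) + (((n + 1 : ℝ≥0)⁻¹ : ℝ≥0) : ℝ≥0∞) * C) := by
    refine (genW_triangle hb μ (μ + (n + 1 : ℝ≥0)⁻¹ • η) ν).trans
      (add_le_add (genW_le_add_smul hb _ _ _) ?_)
    refine (genW_triangle hb _ (ν + (n + 1 : ℝ≥0)⁻¹ • η) ν).trans
      (add_le_add (genW_add_inv_smul_le hb μ ν η n) ?_)
    rw [genW_comm hb]
    exact genW_le_add_smul hb _ _ _
  have h0 : Tendsto (fun n : ℕ => (((n + 1 : ℝ≥0)⁻¹ : ℝ≥0) : ℝ≥0∞) * C) atTop (𝓝 0) := by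
    have h : Tendsto (fun n : ℕ => (((n + 1 : ℝ≥0)⁻¹ : ℝ≥0) : ℝ≥0∞)) atTop (𝓝 ((0 : ℝ≥0) : ℝ≥0∞)) := by
      rw [ENNReal.tendsto_coe]
      simpa using tendsto_one_div_add_atTop_nhds_zero_nat (𝕜 := ℝ≥0)
    simpa using ENNReal.Tendsto.mul_const h (Or.inr hCtop)
  have hlim := h0.add ((tendsto_const_nhds (x := genW a b (μ + η) (ν + η))).add h0)
  rw [add_zero, zero_add] at hlim
  exact ge_of_tendsto' hlim hle

/-! ### Definiteness -/

theorem lintegral_le_of_genW_eq_zero (ha : 0 < a) (hb : 0 < b) {μ ν : FiniteMeasure (Rd d)}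
    (h : genW a b μ ν = 0) {f : Rd d → ℝ≥0} {K : ℝ≥0} (hf : LipschitzWith K f)
    (hf1 : ∀ x, f x ≤ 1) :
    ∫⁻ x, f x ∂(μ : Measure (Rd d)) ≤ ∫⁻ x, f x ∂(ν : Measure (Rd d)) := by
  have ha0 : ENNReal.ofReal a ≠ 0 := by simpa using ha
  have hb0 : ENNReal.ofReal b ≠ 0 := by simpa using hb
  have hf1' : ∀ x, (f x : ℝ≥0∞) ≤ 1 := fun x => by exact_mod_cast hf1 x
  -- For `f ≤ 1` the variation terms cost `1 / a`; the Lipschitz bound on transport costs `K / b`.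
  set C : ℝ≥0∞ := (ENNReal.ofReal a)⁻¹ + K * (ENNReal.ofReal b)⁻¹ with hC
  have hCtop : C ≠ ∞ := by simp [hC, ENNReal.mul_eq_top, ha, hb]
  suffices H : ∫⁻ x, f x ∂(μ : Measure (Rd d)) ≤
      ∫⁻ x, f x ∂(ν : Measure (Rd d)) + C * genW a b μ ν by simpa [h] using H
  rw [genW_eq_iInf_planCost hb, ENNReal.mul_iInf (by simp [hCtop]), ENNReal.add_iInf]
  refine le_iInf fun π => ?_
  set p := (π : Measure (Rd d × Rd d))
  have h₁ := lintegral_le_add_tvDist hf1' (μ : Measure (Rd d)) p.fst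
  have h₂ := lintegral_fst_le_of_lipschitzWith hf p
  have h₃ := lintegral_le_add_tvDist hf1' p.snd (ν : Measure (Rd d))
  rw [tvDist_comm p.snd] at h₃
  have k₁ : tvDist (μ : Measure (Rd d)) p.fst + tvDist (ν : Measure (Rd d)) p.snd ≤
      (ENNReal.ofReal a)⁻¹ * planCost a b μ ν p := by
    rw [planCost, mul_add, ← mul_assoc, ENNReal.inv_mul_cancel ha0 ENNReal.ofReal_ne_top, one_mul]
    exact le_self_add
  have k₂ : ∫⁻ z, edist z.1 z.2 ∂p ≤ (ENNReal.ofReal b)⁻¹ * planCost a b μ ν p := by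
    rw [planCost, mul_add, ← mul_assoc _ (ENNReal.ofReal b),
      ENNReal.inv_mul_cancel hb0 ENNReal.ofReal_ne_top, one_mul]
    exact le_add_self
  calc ∫⁻ x, f x ∂(μ : Measure (Rd d))
      ≤ (∫⁻ x, f x ∂(ν : Measure (Rd d)) + tvDist (ν : Measure (Rd d)) p.snd
          + K * ∫⁻ z, edist z.1 z.2 ∂p) + tvDist (μ : Measure (Rd d)) p.fst :=
        h₁.trans (add_le_add (h₂.trans (add_le_add h₃ le_rfl)) le_rfl)
    _ = ∫⁻ x, f x ∂(ν : Measure (Rd d)) +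
          ((tvDist (μ : Measure (Rd d)) p.fst + tvDist (ν : Measure (Rd d)) p.snd) +
            K * ∫⁻ z, edist z.1 z.2 ∂p) := by ring
    _ ≤ ∫⁻ x, f x ∂(ν : Measure (Rd d)) + ((ENNReal.ofReal a)⁻¹ * planCost a b μ ν p +
          K * ((ENNReal.ofReal b)⁻¹ * planCost a b μ ν p)) := by gcongr
    _ = ∫⁻ x, f x ∂(ν : Measure (Rd d)) + C * planCost a b μ ν p := by rw [hC]; ring

/-- Thickened indicators of `F` are Lipschitz, at most one, and their integrals converge to the
measure of `F`. -/
theorem measure_isClosed_le_of_genW_eq_zero (ha : 0 < a) (hb : 0 < b)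
    {μ ν : FiniteMeasure (Rd d)} (h : genW a b μ ν = 0) {F : Set (Rd d)} (hF : IsClosed F) :
    (μ : Measure (Rd d)) F ≤ (ν : Measure (Rd d)) F := by
  have hpos (n : ℕ) : (0 : ℝ) < 1 / ((n : ℝ) + 1) := by positivity
  have hlim := tendsto_one_div_add_atTop_nhds_zero_nat (𝕜 := ℝ)
  exact le_of_tendsto_of_tendsto'
    (tendsto_lintegral_thickenedIndicator_of_isClosed (μ : Measure (Rd d)) hF hpos hlim)
    (tendsto_lintegral_thickenedIndicator_of_isClosed (ν : Measure (Rd d)) hF hpos hlim)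
    fun n => lintegral_le_of_genW_eq_zero ha hb h (lipschitzWith_thickenedIndicator (hpos n) F)
      (thickenedIndicator_le_one (hpos n) F)

theorem genW_eq_zero_iff (ha : 0 < a) (hb : 0 < b) {μ ν : FiniteMeasure (Rd d)} :
    genW a b μ ν = 0 ↔ μ = ν := by
  refine ⟨fun h => ?_, fun h => h ▸ genW_self hb μ⟩
  have h' : genW a b ν μ = 0 := by rwa [genW_comm hb]
  have hcl {F : Set (Rd d)} (hF : IsClosed F) : (μ : Measure (Rd d)) F = (ν : Measure (Rd d)) F :=
    le_antisymm (measure_isClosed_le_of_genW_eq_zero ha hb h hF)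
      (measure_isClosed_le_of_genW_eq_zero ha hb h' hF)
  apply FiniteMeasure.toMeasure_injective
  refine ext_of_generate_finite {F : Set (Rd d) | IsClosed F}
    (BorelSpace.measurable_eq.trans borel_eq_generateFrom_isClosed) isPiSystem_isClosed
    (fun F hF => hcl hF) (hcl isClosed_univ)

/-! ### Signed measures -/

theorem diff_eq_diff_iff {μ₁ μ₂ ν₁ ν₂ : FiniteMeasure (Rd d)} :
    diff μ₁ μ₂ = diff ν₁ ν₂ ↔ μ₁ + ν₂ = ν₁ + μ₂ := by
  rw [diff, diff, sub_eq_sub_iff_add_eq_add, ← Measure.toSignedMeasure_add,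
    ← Measure.toSignedMeasure_add, Measure.toSignedMeasure_eq_toSignedMeasure_iff,
    ← FiniteMeasure.toMeasure_add, ← FiniteMeasure.toMeasure_add,
    FiniteMeasure.toMeasure_injective.eq_iff]

theorem diff_jordan (σ : SignedMeasure (Rd d)) : diff (jordanPos σ) (jordanNeg σ) = σ :=
  SignedMeasure.toSignedMeasure_toJordanDecomposition σ

theorem genW_eq_signedW (hb : 0 < b) {μ ν : SignedMeasure (Rd d)}
    {μp μm νp νm : FiniteMeasure (Rd d)} (hμ : μ = diff μp μm) (hν : ν = diff νp νm) :
    genW a b (μp + νm) (μm + νp) = signedW a b μ ν := by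
  rw [← diff_jordan μ, diff_eq_diff_iff] at hμ
  rw [← diff_jordan ν, diff_eq_diff_iff] at hν
  -- Each pair receives the other's second entry, so the second entries agree at once and the first
  -- by `hμ`, `hν`.
  rw [signedW, ← genW_add_right hb (μp + νm) (μm + νp) (jordanNeg μ + jordanPos ν),
    ← genW_add_right hb (jordanPos μ + jordanNeg ν) (jordanNeg μ + jordanPos ν) (μm + νp)]
  congr 1
  · calc μp + νm + (jordanNeg μ + jordanPos ν)
        = (μp + jordanNeg μ) + (jordanPos ν + νm) := by abel
      _ = (jordanPos μ + μm) + (νp + jordanNeg ν) := by rw [hμ, hν]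
      _ = jordanPos μ + jordanNeg ν + (μm + νp) := by abel
  · exact add_comm _ _

theorem signedW_comm (hb : 0 < b) (μ ν : SignedMeasure (Rd d)) :
    signedW a b μ ν = signedW a b ν μ := by
  rw [signedW, signedW, genW_comm hb, add_comm (jordanNeg μ), add_comm (jordanPos μ)]

theorem signedW_eq_zero_iff (ha : 0 < a) (hb : 0 < b) {μ ν : SignedMeasure (Rd d)} :
    signedW a b μ ν = 0 ↔ μ = ν := by
  rw [signedW, genW_eq_zero_iff ha hb, add_comm (jordanNeg μ), ← diff_eq_diff_iff, diff_jordan,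
    diff_jordan]

theorem signedW_triangle (hb : 0 < b) (μ ν η : SignedMeasure (Rd d)) :
    signedW a b μ η ≤ signedW a b μ ν + signedW a b ν η := by
  -- With both parts of `ν` added, the pair is the sum of the pairs for `(μ, ν)` and `(ν, η)`.
  rw [signedW, ← genW_add_right hb _ _ (jordanPos ν + jordanNeg ν)]
  refine le_trans (le_of_eq ?_) (genW_add_le hb _ _ _ _)
  congr 1 <;> abel

end SignedWasserstein

theorem proposition17 (d : ℕ) (a b : ℝ) (ha : 0 < a) (hb : 0 < b) :
    -- the value does not depend on the decompositions
    (∀ (μ ν : SignedMeasure (SignedWasserstein.Rd d))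
      (μp μm νp νm : FiniteMeasure (SignedWasserstein.Rd d)),
      μ = SignedWasserstein.diff μp μm → ν = SignedWasserstein.diff νp νm →
        SignedWasserstein.genW a b (μp + νm) (μm + νp) = SignedWasserstein.signedW a b μ ν) ∧
    -- it is finite, and it is a distance
    (∀ μ ν : SignedMeasure (SignedWasserstein.Rd d), SignedWasserstein.signedW a b μ ν ≠ ∞) ∧
    (∀ μ ν : SignedMeasure (SignedWasserstein.Rd d),
      SignedWasserstein.signedW a b μ ν = 0 ↔ μ = ν) ∧
    (∀ μ ν : SignedMeasure (SignedWasserstein.Rd d),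
      SignedWasserstein.signedW a b μ ν = SignedWasserstein.signedW a b ν μ) ∧
    (∀ μ ν η : SignedMeasure (SignedWasserstein.Rd d),
      SignedWasserstein.signedW a b μ η ≤
        SignedWasserstein.signedW a b μ ν + SignedWasserstein.signedW a b ν η) := by
  exact ⟨fun _ _ _ _ _ _ hμ hν => SignedWasserstein.genW_eq_signedW hb hμ hν,
    fun _ _ => SignedWasserstein.genW_ne_top hb _ _,
    fun _ _ => SignedWasserstein.signedW_eq_zero_iff ha hb,
    SignedWasserstein.signedW_comm hb, SignedWasserstein.signedW_triangle hb⟩
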